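/- **Setting.** All graphs are finite. A property graph $G$ is undirected, with labels and property values on its vertices and edges; a query graph $q$ is undirected with labels on vertices and edges and optional constraints on property values. A *matching* of $q$ in $G$ is an injective map $f$ from the vertices of $q$ to those of $G$ that is an isomorphism of $q$ onto the subgraph of $G$ induced by its image, preserves labels and satisfies the constraints. A *hypergraph* over $G$ with query graph $q$ is a multiset of hyperedges; a hyperedge carries a map $f$ from the vertices of $q$ to those of $G$ and has vertex set $V_\epsilon=\operatorname{im} f$, together with values of hyperedge properties (among them the topology of the induced subgraph). $\mathrm{View}$ turns a hypergraph into a relational table with one row per hyperedge; its columns are the properties of the query vertices, of the query edges and of the hyperedge. **Exact operators.** $\mathrm{SOURCE}_{cmpl}(G,q)$ has one hyperedge for each recorded matching, where a fixed rule records at least one matching for each matched induced subgraph (e.g. all matchings, or exactly one for each subgraph). For a set $\sigma$ of equalities between vertex properties, $\mathcal G_1\,\mathrm{JOIN}_{cmpl,\sigma}\,\mathcal G_2$ has one hyperedge for each pair $(\epsilon_1,\epsilon_2)$ satisfying $\sigma$; it lives over the disjoint union of the underlying graphs, and over the disjoint union of the query graphs, with matching $f_1\sqcup f_2$. **Sampling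 operators.** Each returns a multiset of hyperedges together with a sampling rate $\rho$. * $\mathrm{SOURCE}_{fas}(G,q)$ with $n\ge 1$ trials (tree sampling). Fix a rooted forest of edges of $q$ on all vertices of $q$, and candidate vertices and candidate edges such that no matching is excluded. Let $T$ be the number of maps of the forest into the candidate space, computed bottom-up. Each of $n$ independent trials samples such a map top-down, choosing each candidate with probability proportional to its number of subtree maps, and records it as a hyperedge if it is a recorded matching. The rate is $\rho=n/T$. * $\mathrm{JOIN}_{sgs}$ with sample size $r\ge 1$. From sampled hypergraphs $\hat{\mathcal G}_1,\hat{\mathcal G}_2$ with rates $\rho_1,\rho_2$, draw $r$ hyperedges of $\hat{\mathcal G}_1$ independently with replacement, with probability proportional to the number $m(\epsilon)$ of hyperedges of $\hat{\mathcal G}_2$ that can be joined with $\epsilon$ under $\sigma$; join each with one of these chosen uniformly (the result is empty if no pair can be joined). The rate is the realized one, $\rho=r\rho_1\rho_2/W$ with $W=\sum_{\epsilon\in\hat{\mathcal G}_1}m(\epsilon)$. **Theorem.** Let $(\hat{\mathcal G},\rho)$ be the random output of any finite expression tree composed of $\mathrm{SOURCE}_{fas}$ and $\mathrm{JOIN}_{sgs}$,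 where every operator call uses independent randomness. Let $\mathcal G$ be the true result, i.e. the output of the same expression with $\mathrm{SOURCE}_{cmpl}$ and $\mathrm{JOIN}_{cmpl}$, and put $\hat R=\mathrm{View}(\hat{\mathcal G})$, $R=\mathrm{View}(\mathcal G)$. Then $\rho>0$ whenever $\hat{\mathcal G}$ is non-empty, and the Horvitz–Thompson sums over the sampled table (with multiplicity) are unbiased estimators of COUNT and SUM on the true table: $$\mathbb E\Big[\sum_{t\in\hat R}\frac1\rho\Big]=|R|,\qquad \mathbb E\Big[\sum_{t\in\hat R}\frac{X_t}{\rho}\Big]=\sum_{t\in R}X_t ,$$ for every attribute $X$, i.e. every column read as real numbers; both expectations exist. -/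

import Mathlib

universe u v

noncomputable section

open scoped Classical

namespace ExBI

/-! ### Property graphs, query graphs and matchings -/

/-- A finite undirected property graph. The edge set is a subset of the unordered pairs of vertices:
it is given by an index type `E` with an injective map `ends`. `label` is the labelling of vertices
and edges by `L`, and `prop` assigns to vertices and edges the values (in `D`) of the properties
(named by `P`). -/
structure PropertyGraph (L P D : Type v) where
  V : Type u
  E : Type u
  [fintypeV : Fintype V]
  [fintypeE : Fintype E]
  ends : E → Sym2 V
  ends_injective : Function.Injective ends
  label : V ⊕ E → L
  prop : V ⊕ E → P → D

attribute [instance] PropertyGraph.fintypeV PropertyGraph.fintypeE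

/-- A finite query graph. `constraint` holds the optional constraints on the property values of
the image of a query vertex or edge (`fun _ _ => True` when there are none). -/
structure QueryGraph (L P D : Type v) where
  V : Type u
  E : Type u
  [fintypeV : Fintype V]
  [fintypeE : Fintype E]
  ends : E → Sym2 V
  ends_injective : Function.Injective ends
  label : V ⊕ E → L
  constraint : V ⊕ E → (P → D) → Prop

attribute [instance] QueryGraph.fintypeV QueryGraph.fintypeE

variable {L P D : Type v}

/-- Disjoint union of property graphs. -/
def PropertyGraph.union (G G' : PropertyGraph.{u} L P D) : PropertyGraph.{u} L P D where
  V := G.V ⊕ G'.V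
  E := G.E ⊕ G'.E
  ends := Sum.elim (fun e => (G.ends e).map Sum.inl) (fun e => (G'.ends e).map Sum.inr)
  ends_injective := by
    have hl := (Sym2.map.injective (Sum.inl_injective (α := G.V) (β := G'.V))).comp
      G.ends_injective
    have hr := (Sym2.map.injective (Sum.inr_injective (α := G.V) (β := G'.V))).comp
      G'.ends_injective
    refine Function.Injective.sumElim hl hr ?_
    intro a b
    induction G.ends a with | _ x y
    induction G'.ends b with | _ x' y'
    simp
  label := Sum.elim (Sum.elim (fun x => G.label (.inl x)) (fun x => G'.label (.inl x)))
    (Sum.elim (fun e => G.label (.inr e)) (fun e => G'.label (.inr e)))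
  prop := Sum.elim (Sum.elim (fun x => G.prop (.inl x)) (fun x => G'.prop (.inl x)))
    (Sum.elim (fun e => G.prop (.inr e)) (fun e => G'.prop (.inr e)))

/-- The composed query graph of a join. -/
def QueryGraph.union (q q' : QueryGraph.{u} L P D) : QueryGraph.{u} L P D where
  V := q.V ⊕ q'.V
  E := q.E ⊕ q'.E
  ends := Sum.elim (fun e => (q.ends e).map Sum.inl) (fun e => (q'.ends e).map Sum.inr)
  ends_injective := by
    have hl := (Sym2.map.injective (Sum.inl_injective (α := q.V) (β := q'.V))).comp
      q.ends_injective
    have hr := (Sym2.map.injective (Sum.inr_injective (α := q.V) (β := q'.V))).comp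
      q'.ends_injective
    refine Function.Injective.sumElim hl hr ?_
    intro a b
    induction q.ends a with | _ x y
    induction q'.ends b with | _ x' y'
    simp
  label := Sum.elim (Sum.elim (fun x => q.label (.inl x)) (fun x => q'.label (.inl x)))
    (Sum.elim (fun e => q.label (.inr e)) (fun e => q'.label (.inr e)))
  constraint := Sum.elim
    (Sum.elim (fun x => q.constraint (.inl x)) (fun x => q'.constraint (.inl x)))
    (Sum.elim (fun e => q.constraint (.inr e)) (fun e => q'.constraint (.inr e)))

/-- `f` is a matching of `q` in `G`: a bijection of the query vertices onto a vertex set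
`V_s = range f` which is an isomorphism of `q` onto the subgraph of `G` induced by `V_s`, preserving
vertex and edge labels and satisfying the property constraints. -/
structure IsMatching (G : PropertyGraph.{u} L P D) (q : QueryGraph.{u} L P D)
    (f : q.V → G.V) : Prop where
  injective : Function.Injective f
  vertex_label : ∀ x, G.label (.inl (f x)) = q.label (.inl x)
  vertex_constraint : ∀ x, q.constraint (.inl x) (G.prop (.inl (f x)))
  /-- every query edge is mapped to an edge with the same label -/
  edge_map : ∀ e : q.E, ∃ e' : G.E, G.ends e' = (q.ends e).map f ∧
    G.label (.inr e') = q.label (.inr e) ∧ q.constraint (.inr e) (G.prop (.inr e'))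
  /-- every edge of `G` between vertices of the image comes from a query edge -/
  induced : ∀ (e' : G.E) (x y : q.V), G.ends e' = s(f x, f y) → ∃ e : q.E, q.ends e = s(x, y)

/-! ### Hyperedges, hypergraphs, tables -/

/-- Finite graphs up to isomorphism. -/
def topologySetoid : Setoid (Σ n : ℕ, Set (Sym2 (Fin n))) where
  r A B := ∃ φ : Fin A.1 ≃ Fin B.1, Sym2.map φ '' A.2 = B.2
  iseqv :=
    { refl := fun A => ⟨Equiv.refl _, by simp⟩
      symm := by
        rintro A B ⟨φ, h⟩
        refine ⟨φ.symm, ?_⟩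
        rw [← h, ← Set.image_comp, ← Sym2.map_comp]
        simp
      trans := by
        rintro A B C ⟨φ, h⟩ ⟨ψ, h'⟩
        refine ⟨φ.trans ψ, ?_⟩
        rw [← h', ← h, ← Set.image_comp, ← Sym2.map_comp]
        simp }

/-- The possible values of the property `topology`. -/
def Topology : Type := Quotient topologySetoid

/-- A value of a cell of a table: a property value or a topology. -/
inductive Value (D : Type v) : Type v
  | data (d : D)
  | topology (t : Topology)

/-- The connectivity pattern of the subgraph induced on the image of `f`: the isomorphism class of
the graph on the query vertices whose edges are the pairs that `f` maps to edges of `G`. -/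
def topologyOf (G : PropertyGraph.{u} L P D) {U : Type u} [Fintype U] (f : U → G.V) : Topology :=
  Quotient.mk topologySetoid ⟨Fintype.card U,
    {x | ∃ e : G.E, G.ends e = (x.map (Fintype.equivFin U).symm).map f}⟩

/-- A hyperedge over `G` with query graph `q`, with its matching and the values of its hyperedge
properties, which are named by `H`. -/
structure Hyperedge (G : PropertyGraph.{u} L P D) (q : QueryGraph.{u} L P D) (H : Type u) where
  matching : q.V → G.V
  prop : H → Value D

/-- The vertex set `V_ε` of a hyperedge. -/
def Hyperedge.verts {G : PropertyGraph.{u} L P D} {q : QueryGraph.{u} L P D} {H : Type u}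
    (ε : Hyperedge G q H) : Set G.V := Set.range ε.matching

/-- A hypergraph over `G` with query graph `q`, given by its hyperedges. It is a multiset, because
a sampled hypergraph is drawn with replacement. -/
abbrev Hypergraph (G : PropertyGraph.{u} L P D) (q : QueryGraph.{u} L P D) (H : Type u) :=
  Multiset (Hyperedge G q H)

/-- The columns of the table of a hypergraph: the properties of query vertices, the properties of
query edges, and the hyperedge properties. -/
inductive Column (q : QueryGraph.{u} L P D) (H : Type u) : Type (max u v)
  | vertex (x : q.V) (p : P)
  | edge (e : q.E) (p : P)
  | hyperedge (h : H)

/-- A row of a table; the value `none` is NULL. -/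
abbrev Row (q : QueryGraph.{u} L P D) (H : Type u) := Column q H → Option (Value D)

/-- The edge of `G` with the given ends, if there is one. -/
def PropertyGraph.edgeAt (G : PropertyGraph.{u} L P D) (x : Sym2 G.V) : Option G.E :=
  if h : ∃ e, G.ends e = x then some h.choose else none

/-- The row of a hyperedge. -/
def Hyperedge.row {G : PropertyGraph.{u} L P D} {q : QueryGraph.{u} L P D} {H : Type u}
    (ε : Hyperedge G q H) : Row q H
  | .vertex x p => some (.data (G.prop (.inl (ε.matching x)) p))
  | .edge e p => (G.edgeAt ((q.ends e).map ε.matching)).map fun e' => .data (G.prop (.inr e') p)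
  | .hyperedge h => some (ε.prop h)

/-- The View operator: one row for each hyperedge. -/
def view {G : PropertyGraph.{u} L P D} {q : QueryGraph.{u} L P D} {H : Type u}
    (𝓖 : Hypergraph G q H) : Multiset (Row q H) :=
  𝓖.map Hyperedge.row

/-! ### The exact operators -/

/-- Which matchings are recorded as hyperedges. Symmetric matchings have the same vertex set and may
be omitted; at least one matching is recorded for each matched induced subgraph. All matchings
(`keep := fun _ => True`) and exactly one matching per matched subgraph are both allowed. -/
structure Recording (G : PropertyGraph.{u} L P D) (q : QueryGraph.{u} L P D) where
  keep : (q.V → G.V) → Prop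
  covers : ∀ f, IsMatching G q f → ∃ g, IsMatching G q g ∧ keep g ∧ Set.range g = Set.range f

/-- The hyperedge of a matching found by Source. The hyperedge property `none` is the built-in
`topology`; `extra` holds further hyperedge properties, if any. -/
def sourceEdge {G : PropertyGraph.{u} L P D} {q : QueryGraph.{u} L P D} {K : Type u}
    (extra : (q.V → G.V) → K → D) (f : q.V → G.V) : Hyperedge G q (Option K) where
  matching := f
  prop
    | none => .topology (topologyOf G f)
    | some k => .data (extra f k)

/-- The exact Source operator. -/
def sourceCmpl {G : PropertyGraph.{u} L P D} {q : QueryGraph.{u} L P D} {K : Type u}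
    (R : Recording G q) (extra : (q.V → G.V) → K → D) : Hypergraph G q (Option K) :=
  (Finset.univ.filter fun f => IsMatching G q f ∧ R.keep f).val.map (sourceEdge extra)

/-- A join condition: a set of equalities `x.p = x'.p'` between vertex properties. -/
abbrev JoinCondition (q q' : QueryGraph.{u} L P D) := Set ((q.V × P) × (q'.V × P))

section Join

variable {G G' : PropertyGraph.{u} L P D} {q q' : QueryGraph.{u} L P D} {H H' : Type u}

/-- Two hyperedges satisfy the join condition. -/
def Joinable (σ : JoinCondition q q') (ε : Hyperedge G q H) (ε' : Hyperedge G' q' H') : Prop :=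
  ∀ c ∈ σ, G.prop (.inl (ε.matching c.1.1)) c.1.2 = G'.prop (.inl (ε'.matching c.2.1)) c.2.2

/-- The hyperedge obtained by merging two hyperedges. -/
def joinEdge (ε : Hyperedge G q H) (ε' : Hyperedge G' q' H') :
    Hyperedge (G.union G') (q.union q') (H ⊕ H') where
  matching := Sum.map ε.matching ε'.matching
  prop := Sum.elim ε.prop ε'.prop

/-- The hyperedges of `𝓖'` that can be joined with `ε`. -/
def partners (σ : JoinCondition q q') (𝓖' : Hypergraph G' q' H') (ε : Hyperedge G q H) :
    Multiset (Hyperedge G' q' H') :=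
  𝓖'.filter (Joinable σ ε)

/-- The exact Join operator. -/
def joinCmpl (σ : JoinCondition q q') (𝓖 : Hypergraph G q H) (𝓖' : Hypergraph G' q' H') :
    Hypergraph (G.union G') (q.union q') (H ⊕ H') :=
  𝓖.bind fun ε => (partners σ 𝓖' ε).map (joinEdge ε)

end Join

/-! ### Random draws -/

/-- Draw one element uniformly from a multiset; there is no result if it is empty. -/
def draw {α : Type*} (s : Multiset α) : PMF (Option α) :=
  if h : s = 0 then PMF.pure none else (PMF.ofMultiset s h).map some

/-- Draw one element from a multiset with probability proportional to `w`; there is no result if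
the total weight is zero. -/
def drawWeighted {α : Type*} (s : Multiset α) (w : α → ℕ) : PMF (Option α) :=
  draw (s.bind fun a => Multiset.replicate (w a) a)

/-- Perform the random experiments `p a` independently for the entries `a` of a list, and collect
the results of those that succeed. -/
def drawEach {α β : Type*} (p : α → PMF (Option β)) : List α → PMF (List β)
  | [] => PMF.pure []
  | a :: l => (p a).bind fun o => (drawEach p l).map fun m => o.toList ++ m

/-! ### Source by tree sampling -/

/-- A candidate space: candidate vertices for each query vertex, and candidate edges
`link x a y b`, saying that the query edge `xy` may be mapped to the pair `ab`. It is complete, i.e.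
no matching is filtered out. -/
structure CandidateSpace (G : PropertyGraph.{u} L P D) (q : QueryGraph.{u} L P D) where
  cand : q.V → Finset G.V
  link : q.V → G.V → q.V → G.V → Prop
  cand_complete : ∀ f, IsMatching G q f → ∀ x, f x ∈ cand x
  link_complete : ∀ f, IsMatching G q f → ∀ (e : q.E) (x y : q.V), q.ends e = s(x, y) →
    link x (f x) y (f y)

/-- A rooted forest of edges of `q` on all vertices of `q` (for connected `q`, for instance a
rooted spanning tree), with an order of the vertices in which parents come before their children.
The roots are the vertices without parent. -/
structure SpanningForest (q : QueryGraph.{u} L P D) where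
  order : q.V ≃ Fin (Fintype.card q.V)
  parent : q.V → Option q.V
  parent_edge : ∀ x y, parent y = some x → ∃ e, q.ends e = s(x, y)
  parent_lt : ∀ x y, parent y = some x → order x < order y

/-- The query vertices in the order of the forest. -/
def SpanningForest.vertices {q : QueryGraph.{u} L P D} (F : SpanningForest q) : List q.V :=
  (List.finRange (Fintype.card q.V)).map F.order.symm

section Source

variable {G : PropertyGraph.{u} L P D} {q : QueryGraph.{u} L P D}

/-- The candidates for `y` that are linked to the candidate `a` of `x`. -/
def CandidateSpace.next (C : CandidateSpace G q) (x : q.V) (a : G.V) (y : q.V) : Finset G.V :=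
  (C.cand y).filter fun b => C.link x a y b

/-- Bottom-up dynamic programming along the list of query vertices, from the last to the first:
the entry at `(x, a)` is the number of maps of the subtree below `x` into the candidate space that
send `x` to `a`. -/
def treeTable (C : CandidateSpace G q) (F : SpanningForest q) : List q.V → q.V → G.V → ℕ
  | [] => fun _ _ => 1
  | x :: l => Function.update (treeTable C F l) x fun a =>
      ∏ y ∈ Finset.univ.filter fun y => F.parent y = some x,
        ∑ b ∈ C.next x a y, treeTable C F l y b

/-- The number of maps of the subtree below `x` into the candidate space that send `x` to `a`. -/
def treeCount (C : CandidateSpace G q) (F : SpanningForest q) : q.V → G.V → ℕ :=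
  treeTable C F F.vertices

/-- The number of maps of the whole forest into the candidate space. -/
def treeTotal (C : CandidateSpace G q) (F : SpanningForest q) : ℕ :=
  ∏ x ∈ Finset.univ.filter fun x => F.parent x = none, ∑ a ∈ C.cand x, treeCount C F x a

/-- The candidates for `y` that are compatible with a partial assignment. -/
def localCand (C : CandidateSpace G q) (F : SpanningForest q) (g : q.V → Option G.V) (y : q.V) :
    Finset G.V :=
  match F.parent y with
  | none => C.cand y
  | some x =>
    match g x with
    | none => ∅
    | some a => C.next x a y

/-- Top-down sampling: the query vertices in the list are assigned one after the other, each to a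
compatible candidate drawn with probability proportional to `treeCount`. -/
def sampleTree (C : CandidateSpace G q) (F : SpanningForest q) :
    List q.V → (q.V → Option G.V) → PMF (Option (q.V → Option G.V))
  | [], g => PMF.pure (some g)
  | x :: l, g => (drawWeighted (localCand C F g x).val (treeCount C F x)).bind fun o =>
      match o with
      | none => PMF.pure none
      | some a => sampleTree C F l (Function.update g x (some a))

/-- The complete assignment given by an assignment in which every vertex has a value. -/
def complete {U W : Type u} (g : U → Option W) : Option (U → W) :=
  if h : ∀ x, (g x).isSome then some fun x => (g x).get (h x) else none

/-- One trial of tree sampling: sample a map of the forest, and keep it if it is a (recorded)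
matching. -/
def treeTrial (C : CandidateSpace G q) (F : SpanningForest q) (R : Recording G q) :
    PMF (Option (q.V → G.V)) :=
  (sampleTree C F F.vertices fun _ => none).map fun o =>
    (o.bind complete).filter fun f => decide (IsMatching G q f ∧ R.keep f)

end Source

/-! ### The sampling operators and workflows -/

/-- The output of a sampling operator: the sampled hypergraph with its (realized) sampling rate. -/
structure Sampled (G : PropertyGraph.{u} L P D) (q : QueryGraph.{u} L P D) (H : Type u) where
  hypergraph : Hypergraph G q H
  rate : ℝ

/-- SOURCE_fas with `n` independent trials of tree sampling; the sampling rate is `n / T`, where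
`T` is the number of maps of the forest into the candidate space. -/
def sourceFas {G : PropertyGraph.{u} L P D} {q : QueryGraph.{u} L P D} {K : Type u}
    (R : Recording G q) (extra : (q.V → G.V) → K → D) (C : CandidateSpace G q)
    (F : SpanningForest q) (n : ℕ+) : PMF (Sampled G q (Option K)) :=
  (drawEach (fun _ : Unit => treeTrial C F R) (List.replicate n ())).map fun l =>
    { hypergraph := ((l.map (sourceEdge extra) : List _) : Multiset _)
      rate := (n : ℝ) / treeTotal C F }

section JoinSgs

variable {G G' : PropertyGraph.{u} L P D} {q q' : QueryGraph.{u} L P D} {H H' : Type u}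

/-- The total weight `W = ∑ m(ε)` over the hyperedges `ε` of `𝓖`, where `m(ε)` is the number of
hyperedges of `𝓖'` that can be joined with `ε`. -/
def joinWeight (σ : JoinCondition q q') (𝓖 : Hypergraph G q H) (𝓖' : Hypergraph G' q' H') : ℕ :=
  (𝓖.map fun ε => (partners σ 𝓖' ε).card).sum

/-- JOIN_sgs with sample size `r`: draw `r` hyperedges of the first hypergraph, independently and
with probability proportional to the number of their partners; then join each of them with one
partner drawn uniformly. The sampling rate is `r ρ₁ ρ₂ / W`, computed from the inputs at hand. -/
def joinSgs (σ : JoinCondition q q') (r : ℕ+) (S : Sampled G q H) (S' : Sampled G' q' H') :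
    PMF (Sampled (G.union G') (q.union q') (H ⊕ H')) :=
  ((drawEach (fun _ : Unit =>
      drawWeighted S.hypergraph fun ε => (partners σ S'.hypergraph ε).card)
    (List.replicate r ())).bind fun firsts =>
      drawEach (fun ε => (draw (partners σ S'.hypergraph ε)).map (Option.map (joinEdge ε)))
        firsts).map fun l =>
    { hypergraph := (l : Multiset _)
      rate := (r : ℝ) * S.rate * S'.rate / joinWeight σ S.hypergraph S'.hypergraph }

end JoinSgs

/-- A workflow combining Source and Join operators, with the parameters of the operators. It yields
hypergraphs over `G` with query graph `q` and hyperedge properties named by `H`. -/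
inductive Workflow : PropertyGraph.{u} L P D → QueryGraph.{u} L P D → Type u →
    Type (max (u + 1) v)
  | source {G : PropertyGraph.{u} L P D} {q : QueryGraph.{u} L P D} {K : Type u}
      (R : Recording G q) (extra : (q.V → G.V) → K → D) (C : CandidateSpace G q)
      (F : SpanningForest q) (n : ℕ+) : Workflow G q (Option K)
  | join {G G' : PropertyGraph.{u} L P D} {q q' : QueryGraph.{u} L P D} {H H' : Type u}
      (w : Workflow G q H) (w' : Workflow G' q' H') (σ : JoinCondition q q') (r : ℕ+) :
      Workflow (G.union G') (q.union q') (H ⊕ H')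

/-- The true result of a workflow, where all operators are exact. -/
def Workflow.exact {G : PropertyGraph.{u} L P D} {q : QueryGraph.{u} L P D} {H : Type u} :
    Workflow G q H → Hypergraph G q H
  | .source R extra _ _ _ => sourceCmpl R extra
  | .join w w' σ _ => joinCmpl σ w.exact w'.exact

/-- The law of the result of a workflow with the sampling operators. Every operator call uses fresh
randomness, so the two inputs of a join are independent. -/
def Workflow.run {G : PropertyGraph.{u} L P D} {q : QueryGraph.{u} L P D} {H : Type u} :
    Workflow G q H → PMF (Sampled G q H)
  | .source R extra C F n => sourceFas R extra C F n
  | .join w w' σ r => w.run.bind fun S => w'.run.bind fun S' => joinSgs σ r S S'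

/-! ### Aggregates and estimators -/

/-- `Z` has, under the discrete law `p`, a well-defined expectation, and it equals `θ`. -/
def IsUnbiased {α : Type*} (p : PMF α) (Z : α → ℝ) (θ : ℝ) : Prop :=
  HasSum (fun x => (p x).toReal * Z x) θ

section Aggregates

variable {q : QueryGraph.{u} L P D} {H : Type u}

/-- COUNT of a table. -/
def countOf (T : Multiset (Row q H)) : ℝ := T.card

/-- SUM of a column of a table; `num` reads cells (including NULL) as numbers. -/
def sumOf (T : Multiset (Row q H)) (X : Column q H) (num : Option (Value D) → ℝ) : ℝ :=
  (T.map fun r => num (r X)).sum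

/-- The Horvitz–Thompson estimator of COUNT from a table sampled with rate `ρ`. -/
def countEstimator (T : Multiset (Row q H)) (ρ : ℝ) : ℝ := (T.map fun _ => 1 / ρ).sum

/-- The Horvitz–Thompson estimator of SUM from a table sampled with rate `ρ`. -/
def sumEstimator (T : Multiset (Row q H)) (X : Column q H) (num : Option (Value D) → ℝ) (ρ : ℝ) :
    ℝ :=
  (T.map fun r => num (r X) / ρ).sum

end Aggregates

end ExBI

end

noncomputable section

open scoped Classical

namespace ExBI

/-! The claim is proved in a stronger form, `Workflow.expect_run_estimator`: for every real function
`h` of hyperedges, the sample sum of `h` divided by the rate has the exact sum of `h` as its mean.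
COUNT is `h = 1`, SUM is a cell of the row. The generality in `h` is what lets the induction pass
through joins. All laws have finite support, so every expectation is a finite sum.

Source: a map of the forest is drawn with probability `∏ treeCount / branchCount`. Each vertex is a
root or has exactly one parent, so this product telescopes to `1 / T`
(`treeTotal_mul_prod_treeCount`, `toReal_sampleTree_vertices_apply`). Matchings are maps of the
forest, hence `n` trials against the rate `n / T` are unbiased.

Join: for fixed inputs, each draw takes a joinable pair with probability `m(ε) / W * 1 / m(ε) = 1 /
W`. The realized rate cancels `r / W`, leaving the sum over the exact join of the two samples,
divided by `ρ₁ ρ₂` (`expect_joinSgs_estimator`). Fixing a hyperedge of the first sample, this is an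
ordinary estimator in the second one (`sum_map_joinCmpl_div`). Averaging over the second sample and
then over the independent first one uses each induction hypothesis once. -/

/-! ### Expectations under discrete laws with finite support -/

/-- The expectation of `Z` under the discrete law `p`. -/
def expect {α : Type*} (p : PMF α) (Z : α → ℝ) : ℝ := ∑' x, (p x).toReal * Z x

section Expect

variable {α β : Type*}

lemma expect_eq_sum (p : PMF α) (Z : α → ℝ) {s : Finset α} (hs : p.support ⊆ s) :
    expect p Z = ∑ x ∈ s, (p x).toReal * Z x := by
  refine tsum_eq_sum fun x hx => ?_
  have : p x = 0 := by
    by_contra h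
    exact hx (hs ((p.mem_support_iff x).2 h))
  simp [this]

/-- Finite support makes the series summable, so the `tsum` in `expect` is not a default value.
Existence of the expectations in the theorem comes from here. -/
lemma isUnbiased_expect {p : PMF α} (hp : p.support.Finite) (Z : α → ℝ) :
    IsUnbiased p Z (expect p Z) := by
  refine (summable_of_hasFiniteSupport (hp.subset fun x hx => ?_)).hasSum
  rw [PMF.mem_support_iff]
  intro h
  simp [h] at hx

lemma expect_congr {p : PMF α} {Z Z' : α → ℝ} (h : ∀ x ∈ p.support, Z x = Z' x) :
    expect p Z = expect p Z' := by
  refine tsum_congr fun x => ?_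
  by_cases hx : x ∈ p.support
  · rw [h x hx]
  · have : p x = 0 := by simpa [PMF.mem_support_iff] using hx
    simp [this]

lemma expect_const (p : PMF α) (c : ℝ) : expect p (fun _ => c) = c := by
  rw [expect, tsum_mul_right, ← ENNReal.tsum_toReal_eq fun x => p.apply_ne_top x, p.tsum_coe]
  simp

lemma expect_mul_left (p : PMF α) (c : ℝ) (Z : α → ℝ) :
    expect p (fun x => c * Z x) = c * expect p Z := by
  rw [expect, expect, ← tsum_mul_left]
  exact tsum_congr fun x => by ring

lemma expect_add {p : PMF α} (hp : p.support.Finite) (Z Z' : α → ℝ) :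
    expect p (fun x => Z x + Z' x) = expect p Z + expect p Z' := by
  have hs : p.support ⊆ hp.toFinset := by simp
  simp only [expect_eq_sum p _ hs, mul_add, Finset.sum_add_distrib]

lemma expect_finset_sum {ι : Type*} {p : PMF α} (hp : p.support.Finite) (s : Finset ι)
    (Z : ι → α → ℝ) : expect p (fun x => ∑ i ∈ s, Z i x) = ∑ i ∈ s, expect p (Z i) := by
  have hs : p.support ⊆ hp.toFinset := by simp
  simp only [expect_eq_sum p _ hs, Finset.mul_sum]
  exact Finset.sum_comm

lemma expect_multiset_sum {ι : Type*} {p : PMF α} (hp : p.support.Finite) (s : Multiset ι)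
    (Z : ι → α → ℝ) :
    expect p (fun x => (s.map fun i => Z i x).sum) = (s.map fun i => expect p (Z i)).sum := by
  induction s using Multiset.induction_on with
  | empty => simpa using expect_const p 0
  | cons i s ih =>
    simp only [Multiset.map_cons, Multiset.sum_cons]
    rw [expect_add hp, ih]

lemma expect_pure (a : α) (Z : α → ℝ) : expect (PMF.pure a) Z = Z a := by
  rw [expect_eq_sum (s := {a}) _ _ (by simp)]
  simp

lemma finite_support_bind {p : PMF α} {f : α → PMF β} (hp : p.support.Finite)
    (hf : ∀ a, (f a).support.Finite) : (p.bind f).support.Finite := by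
  rw [PMF.support_bind]
  exact hp.biUnion fun a _ => hf a

lemma finite_support_map {p : PMF α} (f : α → β) (hp : p.support.Finite) :
    (p.map f).support.Finite := by
  rw [PMF.support_map]
  exact hp.image f

lemma finite_support_pure (a : α) : (PMF.pure a).support.Finite := by simp

/-- The tower property; with finite supports it is an exchange of two finite sums. -/
lemma expect_bind {p : PMF α} {f : α → PMF β} (hp : p.support.Finite)
    (hf : ∀ a, (f a).support.Finite) (Z : β → ℝ) :
    expect (p.bind f) Z = expect p fun a => expect (f a) Z := by
  have hs : p.support ⊆ hp.toFinset := by simp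
  have hb := finite_support_bind hp hf
  have ht : (p.bind f).support ⊆ hb.toFinset := by simp
  rw [expect_eq_sum _ _ ht, expect_eq_sum _ _ hs]
  have h1 : ∀ b, ((p.bind f) b).toReal = ∑ a ∈ hp.toFinset, (p a).toReal * (f a b).toReal := by
    intro b
    rw [PMF.bind_apply, tsum_eq_sum (s := hp.toFinset), ENNReal.toReal_sum]
    · simp
    · intro a _
      exact ENNReal.mul_ne_top (p.apply_ne_top a) ((f a).apply_ne_top b)
    · intro a ha
      have : p a = 0 := by simpa using ha
      simp [this]
  have h2 : ∀ a ∈ hp.toFinset, (p a).toReal * expect (f a) Z =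
      ∑ b ∈ hb.toFinset, (p a).toReal * (f a b).toReal * Z b := by
    intro a ha
    rw [expect_eq_sum (f a) Z (s := hb.toFinset), Finset.mul_sum]
    · exact Finset.sum_congr rfl fun b _ => by ring
    -- One finset serves all inner sums: what `f a` can reach from a possible `a` is reachable by
    -- the bind.
    · intro b hb'
      have : b ∈ (p.bind f).support :=
        (PMF.mem_support_bind_iff p f b).2 ⟨a, hp.mem_toFinset.1 ha, hb'⟩
      simpa using this
  rw [Finset.sum_congr rfl h2, Finset.sum_comm]
  exact Finset.sum_congr rfl fun b _ => by rw [h1, Finset.sum_mul]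

lemma expect_map {p : PMF α} (hp : p.support.Finite) (f : α → β) (Z : β → ℝ) :
    expect (p.map f) Z = expect p fun a => Z (f a) := by
  rw [← PMF.bind_pure_comp, expect_bind (f := PMF.pure ∘ f) hp fun a => finite_support_pure (f a)]
  exact expect_congr fun a _ => expect_pure _ _

/-! ### Random draws -/

lemma mem_support_draw {s : Multiset α} {a : α} (h : some a ∈ (draw s).support) : a ∈ s := by
  unfold draw at h
  split_ifs at h with hs
  · simp at h
  · simpa [PMF.support_map] using h

lemma finite_support_draw (s : Multiset α) : (draw s).support.Finite := by
  unfold draw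
  split_ifs with hs
  · exact finite_support_pure _
  · refine finite_support_map _ ?_
    rw [PMF.support_ofMultiset]
    exact Finset.finite_toSet _

/-- A failed draw counts as `0`, which for empty `s` agrees with `0 / 0 = 0`. -/
lemma expect_draw (s : Multiset α) (h : α → ℝ) :
    expect (draw s) (fun o => o.elim 0 h) = (s.map h).sum / s.card := by
  unfold draw
  split_ifs with hs
  · simp [expect_pure, hs]
  · have hsub : (PMF.ofMultiset s hs).support ⊆ s.toFinset := by simp
    rw [expect_map ((Finset.finite_toSet _).subset hsub), expect_eq_sum _ _ hsub,
      Finset.sum_multiset_map_count, Finset.sum_div]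
    refine Finset.sum_congr rfl fun a _ => ?_
    simp [PMF.ofMultiset_apply, div_mul_eq_mul_div]

lemma mem_support_drawWeighted {s : Multiset α} {w : α → ℕ} {a : α}
    (h : some a ∈ (drawWeighted s w).support) : a ∈ s := by
  obtain ⟨b, hb, hab⟩ := Multiset.mem_bind.1 (mem_support_draw h)
  rwa [Multiset.eq_of_mem_replicate hab]

lemma finite_support_drawWeighted (s : Multiset α) (w : α → ℕ) :
    (drawWeighted s w).support.Finite := finite_support_draw _

lemma expect_drawWeighted (s : Multiset α) (w : α → ℕ) (h : α → ℝ) :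
    expect (drawWeighted s w) (fun o => o.elim 0 h) =
      (s.map fun a => w a * h a).sum / (s.map w).sum := by
  rw [drawWeighted, expect_draw, Multiset.map_bind, Multiset.sum_bind, Multiset.card_bind]
  congr 2
  · simp
  · simp

lemma mem_support_drawEach {p : α → PMF (Option β)} {l : List α} {m : List β} {b : β}
    (hm : m ∈ (drawEach p l).support) (hb : b ∈ m) : ∃ a ∈ l, some b ∈ (p a).support := by
  induction l generalizing m with
  | nil =>
    have : m = [] := by simpa [drawEach] using hm
    simp [this] at hb
  | cons a l ih =>
    rw [drawEach, PMF.mem_support_bind_iff] at hm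
    obtain ⟨o, ho, hm⟩ := hm
    rw [PMF.support_map] at hm
    obtain ⟨m', hm', rfl⟩ := hm
    rcases List.mem_append.1 hb with hb | hb
    · refine ⟨a, by simp, ?_⟩
      rw [Option.mem_toList] at hb
      rwa [← Option.mem_def.1 hb]
    · obtain ⟨a', ha', h⟩ := ih hm' hb
      exact ⟨a', List.mem_cons_of_mem _ ha', h⟩

lemma finite_support_drawEach {p : α → PMF (Option β)} (hp : ∀ a, (p a).support.Finite)
    (l : List α) : (drawEach p l).support.Finite := by
  induction l with
  | nil => exact finite_support_pure _
  | cons a l ih => exact finite_support_bind (hp a) fun o => finite_support_map _ ih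

/-- Linearity of expectation; a failed experiment leaves no entry in the list and so contributes
`0`. -/
lemma expect_drawEach {p : α → PMF (Option β)} (hp : ∀ a, (p a).support.Finite) (h : β → ℝ)
    (l : List α) : expect (drawEach p l) (fun m => (m.map h).sum) =
      (l.map fun a => expect (p a) fun o => o.elim 0 h).sum := by
  induction l with
  | nil => simp [drawEach, expect_pure]
  | cons a l ih =>
    have hl := finite_support_drawEach hp l
    -- The mean over the tail is viewed as a constant under `p a`, so that both sides become
    -- expectations over the first outcome.
    rw [drawEach, expect_bind (hp a) fun o => finite_support_map _ hl, List.map_cons,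
      List.sum_cons, ← ih, ← expect_const (p a) (expect (drawEach p l) _), ← expect_add (hp a)]
    refine expect_congr fun o _ => ?_
    rw [expect_map hl]
    simp only [List.map_append, List.sum_append]
    rw [expect_add hl, expect_const]
    cases o <;> simp

end Expect

/-! ### Tree sampling -/

/-- Lets point probabilities be read off the formulas for expectations, and conversely. -/
lemma toReal_apply_eq_expect {α : Type*} (p : PMF α) (a : α) [DecidablePred fun x => x = a] :
    (p a).toReal = expect p fun x => if x = a then 1 else 0 := by
  simp [expect]

lemma toReal_drawWeighted_apply {α : Type*} (s : Finset α) (w : α → ℕ) {a : α} (ha : a ∈ s) :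
    (drawWeighted s.val w (some a)).toReal = w a / ∑ b ∈ s, (w b : ℝ) := by
  have h : (fun o : Option α => if o = some a then (1 : ℝ) else 0) =
      fun o => o.elim 0 fun b => if b = a then 1 else 0 := by
    funext o
    cases o <;> simp
  have h' := expect_drawWeighted s.val w fun b => if b = a then 1 else 0
  rw [toReal_apply_eq_expect, h, h']
  change (∑ b ∈ s, (w b : ℝ) * if b = a then 1 else 0) / ((∑ b ∈ s, w b : ℕ) : ℝ) = _
  simp [ha]

section Tree

variable {L P D : Type v} {G : PropertyGraph.{u} L P D} {q : QueryGraph.{u} L P D}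
  (C : CandidateSpace G q) (F : SpanningForest q)

lemma SpanningForest.pairwise_vertices :
    F.vertices.Pairwise fun x y => F.order x < F.order y := by
  rw [SpanningForest.vertices, List.pairwise_map]
  simpa using List.pairwise_lt_finRange _

lemma SpanningForest.mem_vertices (x : q.V) : x ∈ F.vertices := by
  simp only [SpanningForest.vertices, List.mem_map, List.mem_finRange, true_and]
  exact ⟨F.order x, by simp⟩

lemma SpanningForest.prod_vertices {M : Type*} [CommMonoid M] (h : q.V → M) :
    (F.vertices.map h).prod = ∏ x, h x := by
  rw [SpanningForest.vertices, List.map_map, ← Fin.prod_univ_def]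
  exact F.order.symm.prod_comp h

/-- Children come after their parents, so the entries of the children of `x` are final when that of
`x` is computed and are not overwritten later. -/
lemma treeTable_eq_prod {l : List q.V} (hl : l.Pairwise fun x y => F.order x < F.order y)
    (hc : ∀ x ∈ l, ∀ y, F.parent y = some x → y ∈ l) {x : q.V} (hx : x ∈ l) (a : G.V) :
    treeTable C F l x a = ∏ y ∈ Finset.univ.filter fun y => F.parent y = some x,
      ∑ b ∈ C.next x a y, treeTable C F l y b := by
  induction l with
  | nil => simp at hx
  | cons z l ih =>
    rw [List.pairwise_cons] at hl
    -- The head `z` is the least vertex of the list, so it is no child of a vertex in it.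
    have hne : ∀ y, F.parent y = some x → y ≠ z := by
      rintro y hy rfl
      have h1 := F.parent_lt _ _ hy
      rcases List.mem_cons.1 hx with rfl | h
      · exact lt_irrefl _ h1
      · exact lt_asymm h1 (hl.1 x h)
    have hupd : ∀ y, y ≠ z → treeTable C F (z :: l) y = treeTable C F l y := fun y hy => by
      rw [treeTable, Function.update_of_ne hy]
    have hR : (∏ y ∈ Finset.univ.filter fun y => F.parent y = some x,
        ∑ b ∈ C.next x a y, treeTable C F (z :: l) y b) =
        ∏ y ∈ Finset.univ.filter fun y => F.parent y = some x,
          ∑ b ∈ C.next x a y, treeTable C F l y b := by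
      refine Finset.prod_congr rfl fun y hy => ?_
      rw [hupd y (hne y (Finset.mem_filter.1 hy).2)]
    rw [hR]
    by_cases hxz : x = z
    · subst hxz
      rw [treeTable, Function.update_self]
    · have hxl : x ∈ l := (List.mem_cons.1 hx).resolve_left hxz
      rw [hupd x hxz]
      refine ih hl.2 (fun x' hx' y hy => ?_) hxl
      refine (List.mem_cons.1 (hc x' (List.mem_cons_of_mem _ hx') y hy)).resolve_left ?_
      rintro rfl
      exact lt_asymm (F.parent_lt _ _ hy) (hl.1 x' hx')

lemma treeCount_eq_prod (x : q.V) (a : G.V) :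
    treeCount C F x a = ∏ y ∈ Finset.univ.filter fun y => F.parent y = some x,
      ∑ b ∈ C.next x a y, treeCount C F y b :=
  treeTable_eq_prod C F F.pairwise_vertices (fun _ _ y _ => F.mem_vertices y) (F.mem_vertices x) a

/-- The number of ways to extend a map of the forest from the parent of `x` to the subtree
below `x`. -/
def branchCount (f : q.V → G.V) (x : q.V) : ℕ :=
  ∑ b ∈ localCand C F (some ∘ f) x, treeCount C F x b

lemma localCand_some_comp_of_parent (f : q.V → G.V) {x y : q.V} (h : F.parent y = some x) :
    localCand C F (some ∘ f) y = C.next x (f x) y := by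
  simp [localCand, h]

lemma treeCount_eq_prod_branchCount (f : q.V → G.V) (x : q.V) :
    treeCount C F x (f x) =
      ∏ y ∈ Finset.univ.filter fun y => F.parent y = some x, branchCount C F f y := by
  rw [treeCount_eq_prod]
  refine Finset.prod_congr rfl fun y hy => ?_
  rw [branchCount, localCand_some_comp_of_parent C F f (Finset.mem_filter.1 hy).2]

lemma treeTotal_eq_prod_branchCount (f : q.V → G.V) :
    treeTotal C F =
      ∏ y ∈ Finset.univ.filter fun y => F.parent y = none, branchCount C F f y := by
  refine Finset.prod_congr rfl fun y hy => ?_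
  rw [branchCount, localCand, (Finset.mem_filter.1 hy).2]

/-- Group the vertices by their parent: the fibre over `none` gives the total, the fibre over `some
x` gives `treeCount` at `x`. This is the telescoping behind uniform sampling. -/
lemma treeTotal_mul_prod_treeCount (f : q.V → G.V) :
    treeTotal C F * ∏ x, treeCount C F x (f x) = ∏ x, branchCount C F f x := by
  rw [← Finset.prod_fiberwise Finset.univ F.parent (branchCount C F f), Fintype.prod_option,
    treeTotal_eq_prod_branchCount C F f]
  simp only [treeCount_eq_prod_branchCount]

/-! ### Positivity of the counts along a map of the forest into the candidate space. -/

section ForestMap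

variable {f : q.V → G.V} (hf : ∀ x, f x ∈ localCand C F (some ∘ f) x)
include hf

/-- The restriction of `f` to the subtree is itself one of the maps counted. -/
lemma treeCount_pos (x : q.V) : 0 < treeCount C F x (f x) := by
  induction h : Fintype.card q.V - (F.order x : ℕ) using Nat.strong_induction_on generalizing x with
  | _ n ih =>
    rw [treeCount_eq_prod_branchCount]
    refine Finset.prod_pos fun y hy => ?_
    have hlt : (F.order x : ℕ) < F.order y := F.parent_lt _ _ (Finset.mem_filter.1 hy).2
    -- Without this bound the truncated subtraction need not drop strictly from parent to child.
    have := (F.order y).isLt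
    refine (ih _ ?_ y rfl).trans_le
      (Finset.single_le_sum (f := fun b => treeCount C F y b) (fun _ _ => Nat.zero_le _) (hf y))
    omega

lemma branchCount_pos (x : q.V) : 0 < branchCount C F f x :=
  (treeCount_pos C F hf x).trans_le
    (Finset.single_le_sum (f := fun b => treeCount C F x b) (fun _ _ => Nat.zero_le _) (hf x))

lemma treeTotal_pos : 0 < treeTotal C F := by
  rw [treeTotal_eq_prod_branchCount C F f]
  exact Finset.prod_pos fun y _ => branchCount_pos C F hf y

end ForestMap

/-! ### The law of top-down sampling. -/

lemma eq_of_sampleTree_ne_zero {l : List q.V} {g φ : q.V → Option G.V}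
    (h : sampleTree C F l g (some φ) ≠ 0) {x : q.V} (hx : x ∉ l) : φ x = g x := by
  induction l generalizing g with
  | nil =>
    rw [sampleTree, ← PMF.mem_support_iff] at h
    have : φ = g := by simpa using h
    rw [this]
  | cons y l ih =>
    rw [sampleTree, ← PMF.mem_support_iff, PMF.mem_support_bind_iff] at h
    obtain ⟨o, -, ho⟩ := h
    rw [List.mem_cons, not_or] at hx
    cases o with
    | none => simp at ho
    | some a => rw [ih ((PMF.mem_support_iff _ _).1 ho) hx.2, Function.update_of_ne hx.1]

lemma finite_support_sampleTree (l : List q.V) (g : q.V → Option G.V) :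
    (sampleTree C F l g).support.Finite := by
  induction l generalizing g with
  | nil => exact finite_support_pure _
  | cons x l ih =>
    refine finite_support_bind (finite_support_drawWeighted _ _) fun o => ?_
    cases o with
    | none => exact finite_support_pure _
    | some a => exact ih _

/-- The only way to end at `f` is to draw `f x` at each remaining `x`, and each such draw has
probability `treeCount / branchCount`. -/
lemma toReal_sampleTree_apply {f : q.V → G.V} (hf : ∀ x, f x ∈ localCand C F (some ∘ f) x)
    {l : List q.V} (hl : l.Pairwise fun x y => F.order x < F.order y) {g : q.V → Option G.V}
    (hg : ∀ x, x ∉ l → g x = some (f x)) :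
    (sampleTree C F l g (some (some ∘ f))).toReal =
      (l.map fun x => (treeCount C F x (f x) : ℝ) / branchCount C F f x).prod := by
  induction l generalizing g with
  | nil =>
    have : g = some ∘ f := funext fun x => hg x (by simp)
    simp [sampleTree, this]
  | cons x l ih =>
    rw [List.pairwise_cons] at hl
    have hxl : x ∉ l := fun h => lt_irrefl _ (hl.1 x h)
    -- The parent of `x` precedes `x`, so it is already assigned its value under `f`.
    have hloc : localCand C F g x = localCand C F (some ∘ f) x := by
      cases hp : F.parent x with
      | none => simp [localCand, hp]
      | some z =>
        have hz : z ∉ x :: l := by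
          intro hz
          have h1 := F.parent_lt _ _ hp
          rcases List.mem_cons.1 hz with rfl | h
          · exact lt_irrefl _ h1
          · exact lt_asymm h1 (hl.1 z h)
        simp [localCand, hp, hg z hz]
    rw [sampleTree, PMF.bind_apply, tsum_eq_single (some (f x)), ENNReal.toReal_mul, hloc,
      toReal_drawWeighted_apply _ _ (hf x), ih hl.2, List.map_cons, List.prod_cons, branchCount]
    · push_cast
      rfl
    · intro y hy
      by_cases hyx : y = x
      · subst hyx
        simp
      · rw [Function.update_of_ne hyx]
        exact hg y (by simp [hyx, hy])
    · intro o ho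
      cases o with
      | none => simp
      | some a =>
        -- A wrong value drawn at `x` stays, because `x` is not visited again.
        by_contra hne
        have h := eq_of_sampleTree_ne_zero C F (right_ne_zero_of_mul hne) hxl
        rw [Function.update_self] at h
        exact ho h.symm

/-- Tree sampling returns every map of the forest with the same probability. -/
lemma toReal_sampleTree_vertices_apply {f : q.V → G.V}
    (hf : ∀ x, f x ∈ localCand C F (some ∘ f) x) :
    (sampleTree C F F.vertices (fun _ => none) (some (some ∘ f))).toReal = 1 / treeTotal C F := by
  rw [toReal_sampleTree_apply C F hf F.pairwise_vertices fun x hx => absurd (F.mem_vertices x) hx,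
    F.prod_vertices, Finset.prod_div_distrib]
  have hT : (treeTotal C F : ℝ) ≠ 0 := Nat.cast_ne_zero.2 (treeTotal_pos C F hf).ne'
  have hB : (∏ x, (branchCount C F f x : ℝ)) ≠ 0 :=
    Finset.prod_ne_zero_iff.2 fun x _ => Nat.cast_ne_zero.2 (branchCount_pos C F hf x).ne'
  have h : (treeTotal C F : ℝ) * ∏ x, (treeCount C F x (f x) : ℝ) =
      ∏ x, (branchCount C F f x : ℝ) := by
    exact_mod_cast treeTotal_mul_prod_treeCount C F f
  rw [div_eq_div_iff hB hT, one_mul, ← h, mul_comm]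

/-- Forest edges are query edges, so completeness of the candidate space makes every matching a map
of the forest. -/
lemma IsMatching.mem_localCand {f : q.V → G.V} (hf : IsMatching G q f) (x : q.V) :
    f x ∈ localCand C F (some ∘ f) x := by
  cases hp : F.parent x with
  | none => simpa [localCand, hp] using C.cand_complete f hf x
  | some z =>
    obtain ⟨e, he⟩ := F.parent_edge _ _ hp
    rw [localCand_some_comp_of_parent C F f hp, CandidateSpace.next, Finset.mem_filter]
    exact ⟨C.cand_complete f hf x, C.link_complete f hf e z x he⟩

lemma complete_eq_some_iff {U W : Type u} (g : U → Option W) (f : U → W) :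
    complete g = some f ↔ g = some ∘ f := by
  constructor
  · intro h
    unfold complete at h
    split_ifs at h with hg
    rw [Option.some_inj] at h
    subst h
    funext x
    simp
  · rintro rfl
    simp [complete]

variable (R : Recording G q)

lemma finite_support_treeTrial : (treeTrial C F R).support.Finite :=
  finite_support_map _ (finite_support_sampleTree C F _ _)

lemma isMatching_of_mem_support_treeTrial {f : q.V → G.V}
    (h : some f ∈ (treeTrial C F R).support) : IsMatching G q f := by
  rw [treeTrial, PMF.support_map] at h
  obtain ⟨o, -, ho⟩ := h
  rw [Option.filter_eq_some_iff, decide_eq_true_iff] at ho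
  exact ho.2.1

lemma expect_treeTrial (h : (q.V → G.V) → ℝ) :
    expect (treeTrial C F R) (fun o => o.elim 0 h) =
      (∑ f ∈ Finset.univ.filter fun f => IsMatching G q f ∧ R.keep f, h f) / treeTotal C F := by
  have hfin := finite_support_sampleTree C F F.vertices fun _ => none
  rw [treeTrial, expect_map hfin]
  -- Expanding the outcome in indicators of recorded matchings reduces the mean to the point
  -- probabilities `1 / T`.
  have hZ : ∀ o : Option (q.V → Option G.V),
      ((o.bind complete).filter fun f => decide (IsMatching G q f ∧ R.keep f)).elim 0 h =
        ∑ f ∈ Finset.univ.filter fun f => IsMatching G q f ∧ R.keep f,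
          h f * if o = some (some ∘ f) then 1 else 0 := by
    intro o
    have ho : ∀ f, o = some (some ∘ f) ↔ o.bind complete = some f := by
      intro f
      cases o with
      | none => simp
      | some g => simp [complete_eq_some_iff]
    simp only [ho]
    cases o.bind complete with
    | none => simp
    | some f =>
      by_cases hf : IsMatching G q f ∧ R.keep f
      · simp [Option.filter, hf]
      · simp [Option.filter, hf]
  simp only [hZ]
  rw [expect_finset_sum hfin, Finset.sum_div]
  refine Finset.sum_congr rfl fun f hf => ?_
  rw [expect_mul_left, ← toReal_apply_eq_expect, toReal_sampleTree_vertices_apply C F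
    fun x => (Finset.mem_filter.1 hf).2.1.mem_localCand C F x, mul_one_div]

end Tree

/-! ### The sampling operators and workflows -/

section Operators

variable {L P D : Type v}

/-- The Horvitz–Thompson estimator of the total of `h` over the hyperedges. -/
def Sampled.estimator {G : PropertyGraph.{u} L P D} {q : QueryGraph.{u} L P D} {H : Type u}
    (S : Sampled G q H) (h : Hyperedge G q H → ℝ) : ℝ :=
  (S.hypergraph.map h).sum / S.rate

/-! ### Tree sampling as an unbiased source. -/

section Source

variable {G : PropertyGraph.{u} L P D} {q : QueryGraph.{u} L P D} {K : Type u}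
  (R : Recording G q) (extra : (q.V → G.V) → K → D) (C : CandidateSpace G q)
  (F : SpanningForest q) (n : ℕ+)

lemma finite_support_sourceFas : (sourceFas R extra C F n).support.Finite :=
  finite_support_map _ (finite_support_drawEach (fun _ => finite_support_treeTrial C F R) _)

lemma rate_pos_of_mem_support_sourceFas {S : Sampled G q (Option K)}
    (hS : S ∈ (sourceFas R extra C F n).support) (h : S.hypergraph ≠ 0) : 0 < S.rate := by
  rw [sourceFas, PMF.support_map] at hS
  obtain ⟨l, hl, rfl⟩ := hS
  obtain ⟨f, hf⟩ : ∃ f, f ∈ l := by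
    refine List.exists_mem_of_ne_nil l ?_
    rintro rfl
    exact h rfl
  obtain ⟨_, _, hf⟩ := mem_support_drawEach hl hf
  have hm := isMatching_of_mem_support_treeTrial C F R hf
  have hT : 0 < (treeTotal C F : ℝ) :=
    Nat.cast_pos.2 (treeTotal_pos C F fun x => hm.mem_localCand C F x)
  exact div_pos (Nat.cast_pos.2 n.pos) hT

lemma expect_sourceFas_estimator (h : Hyperedge G q (Option K) → ℝ) :
    expect (sourceFas R extra C F n) (fun S => S.estimator h) =
      ((sourceCmpl R extra).map h).sum := by
  have hfin := finite_support_treeTrial C F R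
  rw [sourceFas, expect_map (finite_support_drawEach (fun _ => hfin) _)]
  have hZ : ∀ l : List (q.V → G.V), (Sampled.mk (l.map (sourceEdge extra) :
        Hypergraph G q (Option K)) ((n : ℝ) / treeTotal C F)).estimator h =
      (treeTotal C F / (n : ℝ)) * (l.map (h ∘ sourceEdge extra)).sum := by
    intro l
    rw [Sampled.estimator, div_eq_mul_inv, inv_div, mul_comm]
    simp
  simp only [hZ]
  rw [expect_mul_left, expect_drawEach fun _ => hfin, List.map_replicate, List.sum_replicate,
    expect_treeTrial, sourceCmpl, Multiset.map_map, nsmul_eq_mul]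
  change _ * (_ * ((∑ f ∈ Finset.univ.filter fun f => IsMatching G q f ∧ R.keep f,
    (h ∘ sourceEdge extra) f) / _)) = ∑ f ∈ Finset.univ.filter fun f => IsMatching G q f ∧ R.keep f,
    (h ∘ sourceEdge extra) f
  have hn : (n : ℝ) ≠ 0 := Nat.cast_ne_zero.2 n.ne_zero
  -- A matching would force `T > 0`; for `T = 0` both sums are therefore empty.
  by_cases hT : (treeTotal C F : ℝ) = 0
  · rw [Finset.filter_eq_empty_iff.2]
    · simp
    · rintro f - ⟨hf, -⟩
      exact (treeTotal_pos C F fun x => hf.mem_localCand C F x).ne' (Nat.cast_eq_zero.1 hT)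
  · field_simp

end Source

/-! ### The sampling join for fixed inputs. -/

section Join

variable {G G' : PropertyGraph.{u} L P D} {q q' : QueryGraph.{u} L P D} {H H' : Type u}
  (σ : JoinCondition q q') (r : ℕ+)

/-- The join as the image of the law of the list of joined hyperedges. -/
lemma joinSgs_eq_map (S : Sampled G q H) (S' : Sampled G' q' H') :
    joinSgs σ r S S' = ((drawEach (fun _ : Unit =>
        drawWeighted S.hypergraph fun ε => (partners σ S'.hypergraph ε).card)
      (List.replicate r ())).bind fun firsts =>
        drawEach (fun ε => (draw (partners σ S'.hypergraph ε)).map (Option.map (joinEdge ε)))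
          firsts).map fun l : List (Hyperedge (G.union G') (q.union q') (H ⊕ H')) =>
      { hypergraph := (l : Multiset _)
        rate := (r : ℝ) * S.rate * S'.rate / joinWeight σ S.hypergraph S'.hypergraph } := by
  rw [joinSgs]
  -- The definition contains an extra bind with `PMF.pure`, which coerces the list to a multiset; it
  -- is absorbed into the final map.
  change PMF.map _ (PMF.bind _ fun l => PMF.pure _) = _
  rw [PMF.map_bind, ← PMF.bind_pure_comp]
  simp only [PMF.pure_map]
  rfl

lemma finite_support_joinSgs (S : Sampled G q H) (S' : Sampled G' q' H') :
    (joinSgs σ r S S').support.Finite := by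
  rw [joinSgs_eq_map]
  exact finite_support_map _ (finite_support_bind
    (finite_support_drawEach (fun _ => finite_support_drawWeighted _ _) _)
    fun _ => finite_support_drawEach (fun _ => finite_support_map _ (finite_support_draw _)) _)

lemma joinWeight_pos {σ : JoinCondition q q'} {𝓖 : Hypergraph G q H} {𝓖' : Hypergraph G' q' H'}
    {ε : Hyperedge G q H} (hε : ε ∈ 𝓖) (h : partners σ 𝓖' ε ≠ 0) : 0 < joinWeight σ 𝓖 𝓖' :=
  (Multiset.card_pos.2 h).trans_le
    (Multiset.single_le_sum (fun _ _ => Nat.zero_le _) _ (Multiset.mem_map_of_mem _ hε))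

lemma ne_zero_of_joinWeight_ne_zero {σ : JoinCondition q q'} {𝓖 : Hypergraph G q H}
    {𝓖' : Hypergraph G' q' H'} (h : joinWeight σ 𝓖 𝓖' ≠ 0) : 𝓖 ≠ 0 ∧ 𝓖' ≠ 0 := by
  constructor
  · rintro rfl
    exact h rfl
  · rintro rfl
    exact h (by simp [joinWeight, partners])

lemma joinWeight_ne_zero_of_mem_support_joinSgs {S : Sampled G q H} {S' : Sampled G' q' H'}
    {T : Sampled (G.union G') (q.union q') (H ⊕ H')} (hT : T ∈ (joinSgs σ r S S').support)
    (h : T.hypergraph ≠ 0) : joinWeight σ S.hypergraph S'.hypergraph ≠ 0 := by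
  rw [joinSgs_eq_map, PMF.support_map] at hT
  obtain ⟨l, hl, rfl⟩ := hT
  obtain ⟨η, hη⟩ : ∃ η, η ∈ l := by
    refine List.exists_mem_of_ne_nil l ?_
    rintro rfl
    exact h rfl
  rw [PMF.mem_support_bind_iff] at hl
  obtain ⟨firsts, hfirsts, hl⟩ := hl
  obtain ⟨ε, hε, hη⟩ := mem_support_drawEach hl hη
  obtain ⟨_, _, hε⟩ := mem_support_drawEach hfirsts hε
  rw [PMF.support_map] at hη
  obtain ⟨o, ho, hη⟩ := hη
  obtain ⟨ε', rfl, -⟩ := Option.map_eq_some_iff.1 hη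
  refine (joinWeight_pos (mem_support_drawWeighted hε) ?_).ne'
  intro h0
  simpa [h0] using mem_support_draw ho

lemma rate_of_mem_support_joinSgs {S : Sampled G q H} {S' : Sampled G' q' H'}
    {T : Sampled (G.union G') (q.union q') (H ⊕ H')} (hT : T ∈ (joinSgs σ r S S').support) :
    T.rate = (r : ℝ) * S.rate * S'.rate / joinWeight σ S.hypergraph S'.hypergraph := by
  rw [joinSgs_eq_map, PMF.support_map] at hT
  obtain ⟨l, -, rfl⟩ := hT
  rfl

lemma sum_map_joinCmpl (h : Hyperedge (G.union G') (q.union q') (H ⊕ H') → ℝ)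
    (𝓖 : Hypergraph G q H) (𝓖' : Hypergraph G' q' H') :
    ((joinCmpl σ 𝓖 𝓖').map h).sum =
      (𝓖.map fun ε => ((partners σ 𝓖' ε).map fun ε' => h (joinEdge ε ε')).sum).sum := by
  simp [joinCmpl, Multiset.map_bind, Multiset.sum_bind]

/-- Moving the join condition into the summand gives a sum over the whole second hypergraph, to
which unbiasedness for arbitrary functions applies. -/
lemma sum_map_partners (𝓖' : Hypergraph G' q' H') (ε : Hyperedge G q H)
    (h : Hyperedge G' q' H' → ℝ) :
    ((partners σ 𝓖' ε).map h).sum =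
      (𝓖'.map fun ε' => if Joinable σ ε ε' then h ε' else 0).sum := by
  rw [partners]
  induction 𝓖' using Multiset.induction_on with
  | empty => simp
  | cons a s ih => by_cases ha : Joinable σ ε a <;> simp [ha, ih]

/-- Given its two inputs, the join estimates the total over their exact join. -/
lemma expect_joinSgs_estimator (h : Hyperedge (G.union G') (q.union q') (H ⊕ H') → ℝ)
    {S : Sampled G q H} {S' : Sampled G' q' H'} (hS : S.hypergraph ≠ 0 → 0 < S.rate)
    (hS' : S'.hypergraph ≠ 0 → 0 < S'.rate) :
    expect (joinSgs σ r S S') (fun T => T.estimator h) =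
      ((joinCmpl σ S.hypergraph S'.hypergraph).map h).sum / (S.rate * S'.rate) := by
  have hfin₁ : ∀ _ : Unit, (drawWeighted S.hypergraph
      fun ε => (partners σ S'.hypergraph ε).card).support.Finite :=
    fun _ => finite_support_drawWeighted _ _
  have hfin₂ : ∀ ε : Hyperedge G q H, ((draw (partners σ S'.hypergraph ε)).map
      (Option.map (joinEdge ε))).support.Finite :=
    fun ε => finite_support_map _ (finite_support_draw _)
  have hpair : ∀ ε : Hyperedge G q H, expect ((draw (partners σ S'.hypergraph ε)).map
      (Option.map (joinEdge ε))) (fun o => o.elim 0 h) =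
      ((partners σ S'.hypergraph ε).map fun ε' => h (joinEdge ε ε')).sum /
        (partners σ S'.hypergraph ε).card := by
    intro ε
    rw [expect_map (finite_support_draw _), ← expect_draw]
    exact expect_congr fun o _ => by cases o <;> rfl
  rw [joinSgs_eq_map, expect_map (finite_support_bind (finite_support_drawEach hfin₁ _)
    fun _ => finite_support_drawEach hfin₂ _)]
  have hZ : ∀ (l : List (Hyperedge (G.union G') (q.union q') (H ⊕ H'))) (ρ : ℝ),
      (Sampled.mk (l : Hypergraph _ _ _) ρ).estimator h = ρ⁻¹ * (l.map h).sum := by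
    intro l ρ
    rw [Sampled.estimator, div_eq_mul_inv, mul_comm]
    simp
  simp only [hZ]
  rw [expect_mul_left, expect_bind (finite_support_drawEach hfin₁ _)
    fun _ => finite_support_drawEach hfin₂ _]
  simp only [expect_drawEach hfin₂, hpair]
  rw [expect_drawEach hfin₁, List.map_replicate, List.sum_replicate, expect_drawWeighted,
    sum_map_joinCmpl, nsmul_eq_mul]
  -- The weight `m(ε)` of the first draw cancels the `1 / m(ε)` of the uniform partner, making pairs
  -- equally likely; without partners both sides are `0`.
  have hcancel : ∀ ε : Hyperedge G q H, ((partners σ S'.hypergraph ε).card : ℝ) *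
      (((partners σ S'.hypergraph ε).map fun ε' => h (joinEdge ε ε')).sum /
        (partners σ S'.hypergraph ε).card) =
      ((partners σ S'.hypergraph ε).map fun ε' => h (joinEdge ε ε')).sum := by
    intro ε
    by_cases h0 : partners σ S'.hypergraph ε = 0
    · simp [h0]
    · exact mul_div_cancel₀ _ (Nat.cast_ne_zero.2 (Multiset.card_pos.2 h0).ne')
  simp only [hcancel]
  change _ * (_ * (_ / (joinWeight σ S.hypergraph S'.hypergraph : ℝ))) = _
  -- If `W = 0`, no pair is joinable, and the exact join of the samples is empty as well.
  by_cases hW : joinWeight σ S.hypergraph S'.hypergraph = 0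
  · have h0 : ∀ ε ∈ S.hypergraph,
        ((partners σ S'.hypergraph ε).map fun ε' => h (joinEdge ε ε')).sum = 0 := by
      intro ε hε
      have : partners σ S'.hypergraph ε = 0 := by
        by_contra hne
        exact (joinWeight_pos hε hne).ne' hW
      simp [this]
    rw [Multiset.map_congr rfl h0]
    simp
  · obtain ⟨h1, h2⟩ := ne_zero_of_joinWeight_ne_zero hW
    have hρ := (hS h1).ne'
    have hρ' := (hS' h2).ne'
    have hW' : (joinWeight σ S.hypergraph S'.hypergraph : ℝ) ≠ 0 := Nat.cast_ne_zero.2 hW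
    have hr : (r : ℝ) ≠ 0 := Nat.cast_ne_zero.2 r.ne_zero
    field_simp

/-- The total over the exact join of two samples, scaled by the sampling rates, as an estimator in
the second sample. -/
lemma sum_map_joinCmpl_div (h : Hyperedge (G.union G') (q.union q') (H ⊕ H') → ℝ)
    (S : Sampled G q H) (S' : Sampled G' q' H') :
    ((joinCmpl σ S.hypergraph S'.hypergraph).map h).sum / (S.rate * S'.rate) =
      S.rate⁻¹ * (S.hypergraph.map fun ε =>
        S'.estimator fun ε' => if Joinable σ ε ε' then h (joinEdge ε ε') else 0).sum := by
  simp only [Sampled.estimator, div_eq_mul_inv, Multiset.sum_map_mul_right]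
  rw [sum_map_joinCmpl, mul_inv]
  simp only [sum_map_partners]
  ring

end Join

/-! ### Induction over workflows. -/

variable {G : PropertyGraph.{u} L P D} {q : QueryGraph.{u} L P D} {H : Type u}

lemma Workflow.finite_support_run (w : Workflow G q H) : w.run.support.Finite := by
  induction w with
  | source R extra C F n => exact finite_support_sourceFas R extra C F n
  | join w w' σ r ih ih' =>
    exact finite_support_bind ih fun S => finite_support_bind ih' fun S' =>
      finite_support_joinSgs σ r S S'

/-- A non-empty join has `W ≠ 0`, hence two non-empty inputs, whose rates are positive by induction.
-/
lemma Workflow.rate_pos (w : Workflow G q H) {S : Sampled G q H} (hS : S ∈ w.run.support)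
    (h : S.hypergraph ≠ 0) : 0 < S.rate := by
  induction w with
  | source R extra C F n => exact rate_pos_of_mem_support_sourceFas R extra C F n hS h
  | join w w' σ r ih ih' =>
    rw [Workflow.run, PMF.mem_support_bind_iff] at hS
    obtain ⟨S₁, hS₁, hS⟩ := hS
    rw [PMF.mem_support_bind_iff] at hS
    obtain ⟨S₂, hS₂, hS⟩ := hS
    have hW := joinWeight_ne_zero_of_mem_support_joinSgs σ r hS h
    obtain ⟨h₁, h₂⟩ := ne_zero_of_joinWeight_ne_zero hW
    rw [rate_of_mem_support_joinSgs σ r hS]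
    exact div_pos (mul_pos (mul_pos (Nat.cast_pos.2 r.pos) (ih hS₁ h₁)) (ih' hS₂ h₂))
      (Nat.cast_pos.2 (Nat.pos_of_ne_zero hW))

/-- The Horvitz–Thompson estimator of the total of any function of the hyperedges is unbiased. -/
lemma Workflow.expect_run_estimator (w : Workflow G q H) (h : Hyperedge G q H → ℝ) :
    expect w.run (fun S => S.estimator h) = (w.exact.map h).sum := by
  -- The type of `h` depends on the indices of `w`, so the induction hypotheses hold for all `h`.
  -- Here `ih` is used for the sum over exact partners of `ε`.
  induction w with
  | source R extra C F n => exact expect_sourceFas_estimator R extra C F n h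
  | join w w' σ r ih ih' =>
    rw [Workflow.run, expect_bind w.finite_support_run fun S => finite_support_bind
      w'.finite_support_run fun S' => finite_support_joinSgs σ r S S', Workflow.exact, sum_map_joinCmpl,
      ← ih]
    refine expect_congr fun S hS => ?_
    rw [expect_bind w'.finite_support_run fun S' => finite_support_joinSgs σ r S S',
      Sampled.estimator, div_eq_mul_inv, mul_comm]
    -- With `S` fixed, `ih'` is applied for each `ε` separately, to the function cut off by the join
    -- condition.
    simp only [sum_map_partners, ← ih']
    rw [← expect_multiset_sum w'.finite_support_run, ← expect_mul_left]
    refine expect_congr fun S' hS' => ?_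
    rw [expect_joinSgs_estimator σ r h (w.rate_pos hS) (w'.rate_pos hS'), sum_map_joinCmpl_div]

end Operators

end ExBI
end

theorem mainTheorem1 {L P D : Type v} {G : ExBI.PropertyGraph.{u} L P D}
    {q : ExBI.QueryGraph.{u} L P D} {H : Type u} (w : ExBI.Workflow G q H) :
    (∀ S ∈ w.run.support, S.hypergraph ≠ 0 → 0 < S.rate) ∧
    ExBI.IsUnbiased w.run (fun S => ExBI.countEstimator (ExBI.view S.hypergraph) S.rate)
      (ExBI.countOf (ExBI.view w.exact)) ∧
    ∀ (X : ExBI.Column q H) (num : Option (ExBI.Value D) → ℝ),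
      ExBI.IsUnbiased w.run (fun S => ExBI.sumEstimator (ExBI.view S.hypergraph) X num S.rate)
        (ExBI.sumOf (ExBI.view w.exact) X num) := by
  have key : ∀ h : ExBI.Hyperedge G q H → ℝ,
      ExBI.IsUnbiased w.run (fun S => S.estimator h) (w.exact.map h).sum := fun h =>
    w.expect_run_estimator h ▸ ExBI.isUnbiased_expect w.finite_support_run _
  refine ⟨fun S hS h => w.rate_pos hS h, ?_, fun X num => ?_⟩
  · convert key fun _ => 1 using 1
    · funext S
      simp [ExBI.countEstimator, ExBI.view, ExBI.Sampled.estimator, div_eq_mul_inv]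
    · simp [ExBI.countOf, ExBI.view]
  · convert key fun ε => num (ε.row X) using 1
    · funext S
      simp [ExBI.sumEstimator, ExBI.view, ExBI.Sampled.estimator, div_eq_mul_inv,
        Multiset.sum_map_mul_right]
    · simp [ExBI.sumOf, ExBI.view]
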